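/- Let $m,n\ge 0$. The inorder labeling of a binary tree with $n$ internal nodes labels its nodes by $1,\dots,n$ so that each node has a label larger than all labels in its left subtree and smaller than all labels in its right subtree. Write $\lambda(T,i)$ for the product of the numbers of leaves in the left and right subtrees of the $i$-th node of $T$ in inorder. Let $\mathsf{Asso}_n\subset\mathbb R^n$ be the convex hull of the points $(\lambda(T,1),\dots,\lambda(T,n))$ over all binary trees $T$ with $n$ nodes, let $\overline{\mathsf{Asso}}_m=(m+1)\mathbf 1-\mathsf{Asso}_m$, and let the $(m,n)$-biassociahedron be the Minkowski sum $$\mathsf B_{m,n}=\big(\overline{\mathsf{Asso}}_m\times\mathsf{Asso}_n\big)+\sum_{i\in[m],\,j\in[n]}[\mathbf e_i,\mathbf e_{m+j}]\subset\mathbb R^{m+n}.$$ A binary $(m,n)$-bitree is a triple $(U,D,\mu)$ where $U$ and $D$ are binary trees with $m$ and $n$ nodes, labeled in inorder by $1,\dots,m$ and $m+1,\dots,m+n$ respectively, and $\mu$ is an ordered partition (into nonempty parts, listed from bottom to top) of the nodes of $U$ and $D$ such that: no part meets both $U$ and $D$; no two consecutive parts are both contained in $U$ or both contained in $D$; the part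 of each non-root node of $U$ (resp. $D$) is equal to or after (resp. equal to or before) the part of its parent. Its order $\preccurlyeq$ on $[m+n]$ is given by $i\preccurlyeq j$ if the part of $i$ is strictly before the part of $j$, or there is a (possibly empty) path from $i$ to $j$ in $U$ oriented towards the leaves or in $D$ oriented towards the root. A node is below another one if its part is strictly before the part of the other. Each binary $(m,n)$-bitree corresponds to exactly one vertex of $\mathsf B_{m,n}$, namely the vertex whose normal cone (the cone of linear functionals maximized over $\mathsf B_{m,n}$ at this vertex) is $\{\mathbf x\in\mathbb R^{m+n} : x_i\le x_j \text{ whenever } i\preccurlyeq j\}$, and each vertex of $\mathsf B_{m,n}$ corresponds to exactly one binary $(m,n)$-bitree. For $i\in[m+n]$, the $i$-th coordinate of the vertex corresponding to $(U,D,\mu)$ is - if $i\le m$: $m+1-\lambda(U,i)$ plus the number of nodes of $D$ below the node of $U$ labeled $i$; - if $i\ge m+1$: $\lambda(D,i-m)$ plus the number of nodes of $U$ below the node of $D$ labeled $i$. In particular, the sum of the coordinates is always $\binom{m+1}{2}+\binom{n+1}{2}+mn$. -/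

import Mathlib

open scoped Pointwise

namespace Biassociahedra

/-! ### Binary trees labelled in inorder

A binary `n`-tree is a `T : BinaryTree Unit` with `n` internal nodes, equivalently `n + 1` leaves.
Its nodes are identified with their inorder labels, counted from `0`: in `node () l r`, the labels
smaller than `l.numNodes` belong to `l`, the label `l.numNodes` is the root, and the larger labels,
shifted down by `l.numNodes + 1`, belong to `r`. -/

/-- The subtree of `T` rooted at the node with inorder label `i`
(the leaf `nil` if there is no such node). -/
def subtreeAt : BinaryTree Unit → ℕ → BinaryTree Unit
  | .nil, _ => .nil
  | .node v l r, i =>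
    if i < l.numNodes then subtreeAt l i
    else if i = l.numNodes then .node v l r
    else subtreeAt r (i - (l.numNodes + 1))

/-- The product of the numbers of leaves in the left and right subtrees of the root. -/
def rootLeafProduct : BinaryTree Unit → ℕ
  | .nil => 0
  | .node _ l r => l.numLeaves * r.numLeaves

/-- The product of the numbers of leaves in the left and right subtrees of the node of `T`
with inorder label `i`. -/
def leafProduct (T : BinaryTree Unit) (i : ℕ) : ℕ :=
  rootLeafProduct (subtreeAt T i)

/-- There is a (possibly empty) path towards the root from the node of `T` with inorder label `i`
to the node of `T` with inorder label `j`, that is, `i` lies in the subtree rooted at `j`. -/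
def IsDescendant : BinaryTree Unit → ℕ → ℕ → Prop
  | .nil, _, _ => False
  | .node _ l r, i, j =>
    (j = l.numNodes ∧ i < l.numNodes + r.numNodes + 1) ∨
    (j < l.numNodes ∧ i < l.numNodes ∧ IsDescendant l i j) ∨
    (l.numNodes < j ∧ l.numNodes < i ∧
      IsDescendant r (i - (l.numNodes + 1)) (j - (l.numNodes + 1)))

/-! ### Polytopes, faces and normal cones -/

/-- `F` is a (nonempty) face of `P`: the set of points of `P` that maximize some linear functional.
The zero functional gives `P` itself. -/
def IsFace {ι : Type*} [Fintype ι] (P F : Set (ι → ℝ)) : Prop :=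
  F.Nonempty ∧ ∃ c : ι → ℝ, F = {x | x ∈ P ∧ ∀ y ∈ P, c ⬝ᵥ y ≤ c ⬝ᵥ x}

/-- `v` is a vertex of `P`. -/
def IsVertex {ι : Type*} [Fintype ι] (P : Set (ι → ℝ)) (v : ι → ℝ) : Prop :=
  IsFace P {v}

/-- The normal cone of a face `F` of `P`: the linear functionals maximized over `P` by all of `F`. -/
def normalCone {ι : Type*} [Fintype ι] (P F : Set (ι → ℝ)) : Set (ι → ℝ) :=
  {c | ∀ f ∈ F, ∀ p ∈ P, c ⬝ᵥ p ≤ c ⬝ᵥ f}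

/-- The associahedron in `ℝⁿ`, as the convex hull of Loday's points. -/
def associahedron (n : ℕ) : Set (Fin n → ℝ) :=
  convexHull ℝ {v | ∃ T : BinaryTree Unit, T.numNodes = n ∧ ∀ i : Fin n, v i = leafProduct T i}

/-- The anti-associahedron `(n + 1) 𝟙 - Asso(n)` in `ℝⁿ`. -/
def antiAssociahedron (n : ℕ) : Set (Fin n → ℝ) :=
  {x | ∃ y ∈ associahedron n, ∀ i, x i = (n + 1 : ℝ) - y i}

/-! The coordinates of `ℝᵐ⁺ⁿ` are indexed by `Fin m ⊕ Fin n`: the first `m` coordinates by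
`Sum.inl` and the last `n` coordinates by `Sum.inr`. -/

/-- The Cartesian product of `P ⊆ ℝᵐ` and `Q ⊆ ℝⁿ`, as a subset of `ℝᵐ⁺ⁿ`. -/
def cartesianProduct {m n : ℕ} (P : Set (Fin m → ℝ)) (Q : Set (Fin n → ℝ)) :
    Set (Fin m ⊕ Fin n → ℝ) :=
  {x | (fun i => x (Sum.inl i)) ∈ P ∧ (fun j => x (Sum.inr j)) ∈ Q}

/-- The graphical zonotope of the complete bipartite graph: the Minkowski sum of the segments
`[eᵢ, eₘ₊ⱼ]` for `i ∈ [m]` and `j ∈ [n]`. -/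
noncomputable def bipartiteZonotope (m n : ℕ) : Set (Fin m ⊕ Fin n → ℝ) :=
  ∑ i : Fin m, ∑ j : Fin n,
    segment ℝ (Pi.single (Sum.inl i) 1 : Fin m ⊕ Fin n → ℝ) (Pi.single (Sum.inr j) 1)

/-- The shuffle of `P ⊆ ℝᵐ` and `Q ⊆ ℝⁿ` (a Minkowski sum). -/
noncomputable def shuffle {m n : ℕ} (P : Set (Fin m → ℝ)) (Q : Set (Fin n → ℝ)) :
    Set (Fin m ⊕ Fin n → ℝ) :=
  cartesianProduct P Q + bipartiteZonotope m n

/-- The `(m,n)`-biassociahedron. -/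
noncomputable def biassociahedron (m n : ℕ) : Set (Fin m ⊕ Fin n → ℝ) :=
  shuffle (antiAssociahedron m) (associahedron n)

/-! ### Binary bitrees -/

/-- An ordered partition of a finite set `α` into nonempty parts, given by the function sending an
element to the position (from `0`) of its part. The positions that occur form an initial segment
of `ℕ`, so that the parts are exactly the fibres over this segment. -/
@[ext]
structure OrderedPartition (α : Type*) where
  part : α → ℕ
  exists_part_eq : ∀ x : α, ∀ k < part x, ∃ y : α, part y = k

/-- A binary `(m,n)`-bitree `(U, D, μ)`. The nodes of `U` (resp. `D`) are the `Sum.inl i`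
(resp. `Sum.inr j`), for their inorder labels `i` (resp. `j`), and the parts of `μ` are listed from
bottom to top. Since no part meets both trees, there is no condition on nodes of one tree lying in
a common part that meets both trees. -/
@[ext]
structure BinaryBitree (m n : ℕ) where
  U : BinaryTree Unit
  D : BinaryTree Unit
  μ : OrderedPartition (Fin m ⊕ Fin n)
  numNodes_U : U.numNodes = m
  numNodes_D : D.numNodes = n
  /-- `U` grows up: a node lies in the same part as its ancestors or in a later one. -/
  up : ∀ i j : Fin m, IsDescendant U i j → μ.part (Sum.inl j) ≤ μ.part (Sum.inl i)
  /-- `D` grows down: a node lies in the same part as its ancestors or in an earlier one. -/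
  down : ∀ i j : Fin n, IsDescendant D i j → μ.part (Sum.inr i) ≤ μ.part (Sum.inr j)
  /-- No part meets both `U` and `D`. -/
  pure : ∀ x y, μ.part x = μ.part y → x.isLeft = y.isLeft
  /-- No two consecutive parts are both contained in `U` or both contained in `D`. -/
  alternating : ∀ x y, μ.part y = μ.part x + 1 → x.isLeft ≠ y.isLeft

namespace BinaryBitree

variable {m n : ℕ}

/-- The partial order `≼` of a bitree: `x ≼ y` when the part of `x` is strictly before the part
of `y`, or there is a path from `x` to `y` in `U` oriented towards its leaves or in `D` oriented
towards its root. -/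
def Rel (B : BinaryBitree m n) (x y : Fin m ⊕ Fin n) : Prop :=
  B.μ.part x < B.μ.part y ∨
  (∃ i j : Fin m, x = Sum.inl i ∧ y = Sum.inl j ∧ IsDescendant B.U j i) ∨
  (∃ i j : Fin n, x = Sum.inr i ∧ y = Sum.inr j ∧ IsDescendant B.D i j)

/-- The cone of the points `c` with `c x ≤ c y` whenever `x ≼ y`. -/
def cone (B : BinaryBitree m n) : Set (Fin m ⊕ Fin n → ℝ) :=
  {c | ∀ x y, B.Rel x y → c x ≤ c y}

/-- `v` is the vertex of the biassociahedron corresponding to the binary bitree `B`, that is,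
the vertex whose normal cone is the cone of `B`. -/
def IsVertexOf (B : BinaryBitree m n) (v : Fin m ⊕ Fin n → ℝ) : Prop :=
  IsVertex (biassociahedron m n) v ∧ normalCone (biassociahedron m n) {v} = B.cone

/-- The number of nodes of `D` below the node of `U` labelled `i`. -/
def numBelowU (B : BinaryBitree m n) (i : Fin m) : ℕ :=
  (Finset.univ.filter fun j : Fin n => B.μ.part (Sum.inr j) < B.μ.part (Sum.inl i)).card

/-- The number of nodes of `U` below the node of `D` labelled `j`. -/
def numBelowD (B : BinaryBitree m n) (j : Fin n) : ℕ :=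
  (Finset.univ.filter fun i : Fin m => B.μ.part (Sum.inl i) < B.μ.part (Sum.inr j)).card

end BinaryBitree

end Biassociahedra

/-!
The number `λ(T, i)` counts the pairs `a ≤ b` of labels of `T` whose lowest common ancestor is
`i`, so Loday's point of `T` is the sum of the basis vectors `e_{lca(a, b)}` over all pairs
`a ≤ b`. If a functional `c` increases towards the root of `T`, then `c (lca(a, b))` is the maximum
of `c` on the interval `[a, b]`; hence Loday's point of `T` maximizes `c` over the associahedron,
and Loday's point of another tree does as well exactly when `c` increases towards the root of that
tree too. Likewise a segment `[eᵢ, eₘ₊ⱼ]` is maximized by the end at which `c` is larger. Adding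
these contributions, the points given by the coordinate formula for two bitrees `B` and `B'` are
compared term by term: if `c` lies in the cone of `B`, then the point of `B` maximizes `c` over
the biassociahedron, and the point of `B'` does so only if `c` lies in the cone of `B'` as well.

Every functional lies in the cone of some bitree: take Cartesian trees of its two halves, with the
rank of the relation that `y` and `x` lie in different trees and `c y < c x` as ordered partition
(ties of `c` between the two trees being broken first). So the normal cone at the point of `B` is
exactly the cone of `B`. This cone is full-dimensional since it contains a linear extension of
`≼`; therefore its point is a vertex, and it determines both the vertex and the bitree.
-/

namespace Biassociahedra

open scoped Finset

section Polytopes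

variable {ι : Type*} [Fintype ι] {c : ι → ℝ}

theorem convex_setOf_dotProduct_le (c : ι → ℝ) (t : ℝ) : Convex ℝ {p : ι → ℝ | c ⬝ᵥ p ≤ t} :=
  convex_halfSpace_le ⟨dotProduct_add c, fun a p => dotProduct_smul a c p⟩ t

theorem dotProduct_sumElim_sub {α β : Type*} [Fintype α] [Fintype β] (c : α ⊕ β → ℝ) (t : ℝ)
    (y : α → ℝ) (z : β → ℝ) :
    c ⬝ᵥ Sum.elim (fun i => t - y i) z =
      t * ∑ i, c (Sum.inl i) + (fun i => -c (Sum.inl i)) ⬝ᵥ y + (fun j => c (Sum.inr j)) ⬝ᵥ z := by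
  simp only [dotProduct, Fintype.sum_sum_type, Sum.elim_inl, Sum.elim_inr, Finset.mul_sum,
    ← Finset.sum_add_distrib]
  congr 1
  exact Finset.sum_congr rfl fun i _ => by ring

theorem dotProduct_le_sum_of_mem_sum {κ : Type*} [Fintype κ] {S : κ → Set (ι → ℝ)} {t : κ → ℝ}
    (h : ∀ k, ∀ p ∈ S k, c ⬝ᵥ p ≤ t k) {p : ι → ℝ} (hp : p ∈ ∑ k, S k) : c ⬝ᵥ p ≤ ∑ k, t k := by
  obtain ⟨q, hq, rfl⟩ := (Set.mem_fintype_sum _ _).1 hp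
  rw [dotProduct_sum]
  exact Finset.sum_le_sum fun k _ => h k _ (hq k)

theorem eq_of_mem_interior_normalCone {P : Set (ι → ℝ)} {v p : ι → ℝ}
    (hc : c ∈ interior (normalCone P {v})) (hp : p ∈ P) (hle : c ⬝ᵥ v ≤ c ⬝ᵥ p) : p = v := by
  -- Moving `c` slightly towards `p - v` stays in the cone, which forces `‖p - v‖² ≤ 0`.
  have htendsto : Filter.Tendsto (fun ε : ℝ => c + ε • (p - v)) (nhdsWithin 0 (Set.Ioi 0))
      (nhds c) := by
    have hcont : Continuous fun ε : ℝ => c + ε • (p - v) := by fun_prop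
    simpa using (hcont.tendsto 0).mono_left nhdsWithin_le_nhds
  obtain ⟨ε, hε, hε0⟩ :=
    ((htendsto.eventually (mem_interior_iff_mem_nhds.1 hc)).and self_mem_nhdsWithin).exists
  have hmax : (c + ε • (p - v)) ⬝ᵥ (p - v) ≤ 0 := by
    rw [dotProduct_sub, sub_nonpos]
    exact hε v rfl p hp
  rw [add_dotProduct, smul_dotProduct, dotProduct_sub c, smul_eq_mul] at hmax
  have hsq : (p - v) ⬝ᵥ (p - v) ≤ 0 := nonpos_of_mul_nonpos_right (by linarith) hε0
  have hsq0 : 0 ≤ (p - v) ⬝ᵥ (p - v) := Finset.sum_nonneg fun i _ => mul_self_nonneg _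
  exact sub_eq_zero.1 (dotProduct_self_eq_zero.1 (hsq.antisymm hsq0))

theorem isVertex_of_mem_interior_normalCone {P : Set (ι → ℝ)} {v : ι → ℝ} (hv : v ∈ P)
    (hc : c ∈ interior (normalCone P {v})) : IsVertex P v := by
  refine ⟨Set.singleton_nonempty v, c, Set.Subset.antisymm ?_ ?_⟩
  · rintro _ rfl
    exact ⟨hv, interior_subset hc _ rfl⟩
  · rintro p ⟨hp, hmax⟩
    exact eq_of_mem_interior_normalCone hc hp (hmax v hv)

theorem eq_of_normalCone_eq {P : Set (ι → ℝ)} {v w : ι → ℝ} (hv : v ∈ P) (hw : w ∈ P)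
    (h : normalCone P {v} = normalCone P {w}) (hint : (interior (normalCone P {w})).Nonempty) :
    v = w := by
  obtain ⟨c, hc⟩ := hint
  exact eq_of_mem_interior_normalCone hc hv ((h ▸ interior_subset hc) v rfl w hw)

theorem IsVertex.mem {P : Set (ι → ℝ)} {v : ι → ℝ} (h : IsVertex P v) : v ∈ P := by
  obtain ⟨-, c, hc⟩ := h
  exact ((Set.ext_iff.1 hc v).1 rfl).1

theorem IsVertex.exists_unique_maximizer {P : Set (ι → ℝ)} {v : ι → ℝ} (h : IsVertex P v) :
    ∃ c : ι → ℝ, ∀ p ∈ P, (∀ q ∈ P, c ⬝ᵥ q ≤ c ⬝ᵥ p) → p = v := by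
  obtain ⟨-, c, hc⟩ := h
  exact ⟨c, fun p hp hmax => (Set.ext_iff.1 hc p).2 ⟨hp, hmax⟩⟩

end Polytopes

section Descendants

variable {T T' : BinaryTree Unit} {i j k a b : ℕ}

theorem IsDescendant.lt (h : IsDescendant T i j) : i < T.numNodes ∧ j < T.numNodes := by
  induction T generalizing i j with
  | nil => exact h.elim
  | node _ l r _ ihr =>
    simp only [IsDescendant, BinaryTree.numNodes] at *
    grind

theorem isDescendant_node_iff_left {v : Unit} {l r : BinaryTree Unit} (hj : j < l.numNodes) :
    IsDescendant (.node v l r) i j ↔ IsDescendant l i j := by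
  have := @IsDescendant.lt l i j
  simp only [IsDescendant]
  grind

theorem isDescendant_node_iff_right {v : Unit} {l r : BinaryTree Unit} :
    IsDescendant (.node v l r) (l.numNodes + 1 + i) (l.numNodes + 1 + j) ↔
      IsDescendant r i j := by
  simp only [IsDescendant, Nat.add_sub_cancel_left]
  grind

theorem exists_subtreeAt_eq_node (hi : i < T.numNodes) :
    ∃ l r, subtreeAt T i = .node () l r ∧ l.numNodes ≤ i ∧ i + r.numNodes < T.numNodes ∧
      ∀ a, IsDescendant T a i ↔ i ≤ a + l.numNodes ∧ a ≤ i + r.numNodes := by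
  induction T generalizing i with
  | nil => simp [BinaryTree.numNodes] at hi
  | node _ l r ihl ihr =>
    simp only [BinaryTree.numNodes] at hi
    simp only [subtreeAt, IsDescendant, BinaryTree.numNodes]
    rcases lt_trichotomy i l.numNodes with h | rfl | h
    · obtain ⟨l', r', hsub, hl', hr', hdesc⟩ := ihl h
      refine ⟨l', r', by rw [if_pos h, hsub], hl', by omega, fun a => ?_⟩
      rw [hdesc]
      omega
    · refine ⟨l, r, by simp, le_rfl, by omega, fun a => ?_⟩
      omega
    · obtain ⟨l', r', hsub, hl', hr', hdesc⟩ := ihr (i := i - (l.numNodes + 1)) (by omega)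
      refine ⟨l', r', by rw [if_neg h.not_gt, if_neg h.ne', hsub], by omega, by omega, fun a => ?_⟩
      rw [hdesc]
      omega

theorem IsDescendant.refl (hi : i < T.numNodes) : IsDescendant T i i := by
  obtain ⟨l, r, -, -, -, hdesc⟩ := exists_subtreeAt_eq_node hi
  rw [hdesc]
  omega

theorem IsDescendant.trans (hij : IsDescendant T i j) (hjk : IsDescendant T j k) :
    IsDescendant T i k := by
  have hi := hij.lt.1
  induction T generalizing i j k with
  | nil => exact hij.elim
  | node _ l r ihl ihr =>
    simp only [BinaryTree.numNodes, IsDescendant] at *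
    grind [IsDescendant.lt]

theorem IsDescendant.antisymm (hij : IsDescendant T i j) (hji : IsDescendant T j i) : i = j := by
  induction T generalizing i j with
  | nil => exact hij.elim
  | node _ l r ihl ihr =>
    simp only [IsDescendant] at *
    grind

theorem IsDescendant.of_mem_uIcc (ha : IsDescendant T a j) (hb : IsDescendant T b j)
    (hi : i ∈ Set.uIcc a b) : IsDescendant T i j := by
  obtain ⟨l, r, -, -, -, hdesc⟩ := exists_subtreeAt_eq_node ha.lt.2
  rw [hdesc] at *
  rw [Set.mem_uIcc] at hi
  omega

theorem eq_of_isDescendant_imp (hT : T.numNodes = T'.numNodes)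
    (h : ∀ i j, IsDescendant T i j → IsDescendant T' i j) : T = T' := by
  induction T generalizing T' with
  | nil =>
    cases T' with
    | nil => rfl
    | node => simp [BinaryTree.numNodes] at hT
  | node _ l r ihl ihr =>
    cases T' with
    | nil => simp [BinaryTree.numNodes] at hT
    | node _ l' r' =>
      simp only [BinaryTree.numNodes] at hT
      have hroot : l.numNodes = l'.numNodes :=
        IsDescendant.antisymm (T := .node () l' r') (Or.inl ⟨rfl, by omega⟩)
          (h _ _ (Or.inl ⟨rfl, by omega⟩))
      have hl : l = l' := ihl hroot fun i j hij =>
        (isDescendant_node_iff_left (hroot ▸ hij.lt.2)).1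
          (h i j ((isDescendant_node_iff_left hij.lt.2).2 hij))
      have hr : r = r' := ihr (by omega) fun i j hij => by
        have hij' := h _ _ (isDescendant_node_iff_right.2 hij)
        rwa [hroot, isDescendant_node_iff_right] at hij'
      rw [hl, hr]

end Descendants

section LowestCommonAncestor

/-- The inorder label of the lowest common ancestor of the nodes of `T` with inorder labels `i` and
`j`. Counting the pairs `i ≤ j` with a given lowest common ancestor recovers `leafProduct`. The
value is junk if `i` or `j` is not a label of `T`. -/
def lca : BinaryTree Unit → ℕ → ℕ → ℕ
  | .nil, _, _ => 0
  | .node _ l r, i, j =>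
    if i < l.numNodes ∧ j < l.numNodes then lca l i j
    else if l.numNodes < i ∧ l.numNodes < j then
      l.numNodes + 1 + lca r (i - (l.numNodes + 1)) (j - (l.numNodes + 1))
    else l.numNodes

variable {T : BinaryTree Unit} {i j k : ℕ}

theorem lca_comm (T : BinaryTree Unit) (i j : ℕ) : lca T i j = lca T j i := by
  induction T generalizing i j with
  | nil => rfl
  | node _ l r ihl ihr => simp only [lca, and_comm, ihl i, ihr (i - _)]

theorem lca_mem_uIcc (hi : i < T.numNodes) (hj : j < T.numNodes) :
    lca T i j ∈ Set.uIcc i j := by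
  induction T generalizing i j with
  | nil => simp [BinaryTree.numNodes] at hi
  | node _ l r ihl ihr =>
    simp only [BinaryTree.numNodes, Set.mem_uIcc] at *
    grind [lca]

theorem isDescendant_lca_left (hi : i < T.numNodes) (hj : j < T.numNodes) :
    IsDescendant T i (lca T i j) := by
  induction T generalizing i j with
  | nil => simp [BinaryTree.numNodes] at hi
  | node _ l r ihl ihr =>
    have := @lca_mem_uIcc l i j
    simp only [BinaryTree.numNodes, Set.mem_uIcc] at *
    grind [lca, IsDescendant]

theorem isDescendant_lca_right (hi : i < T.numNodes) (hj : j < T.numNodes) :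
    IsDescendant T j (lca T i j) :=
  lca_comm T j i ▸ isDescendant_lca_left hj hi

theorem lca_eq_iff (hi : i < T.numNodes) (hj : j < T.numNodes) :
    lca T i j = k ↔ k ∈ Set.uIcc i j ∧ IsDescendant T i k ∧ IsDescendant T j k := by
  constructor
  · rintro rfl
    exact ⟨lca_mem_uIcc hi hj, isDescendant_lca_left hi hj, isDescendant_lca_right hi hj⟩
  · rintro ⟨hk, hik, hjk⟩
    exact (hik.of_mem_uIcc hjk (lca_mem_uIcc hi hj)).antisymm
      ((isDescendant_lca_left hi hj).of_mem_uIcc (isDescendant_lca_right hi hj) hk)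

end LowestCommonAncestor

/-- The tree `T` has the `n` inorder labels of the sequence `f`, and `f` is weakly increasing along
every path towards the root: `T` is a (max-)Cartesian tree of `f`. -/
def IsCartesianTree {n : ℕ} {L : Type*} [LE L] (T : BinaryTree Unit) (f : Fin n → L) : Prop :=
  T.numNodes = n ∧ ∀ i j : Fin n, IsDescendant T i j → f i ≤ f j

section CartesianTree

variable {n : ℕ} {L : Type*}

theorem exists_isCartesianTree [LinearOrder L] (f : Fin n → L) :
    ∃ T : BinaryTree Unit, IsCartesianTree T f := by
  induction n using Nat.strong_induction_on with
  | _ n ih =>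
    rcases Nat.eq_zero_or_pos n with rfl | hn
    · exact ⟨.nil, rfl, fun i => i.elim0⟩
    · have : Nonempty (Fin n) := ⟨⟨0, hn⟩⟩
      obtain ⟨k, hk⟩ := Finite.exists_max f
      obtain ⟨l, hl, hfl⟩ := ih k k.2 fun i => f ⟨i, by omega⟩
      obtain ⟨r, hr, hfr⟩ := ih (n - (k + 1)) (by omega) fun i => f ⟨i + (k + 1), by omega⟩
      refine ⟨.node () l r, by simp only [BinaryTree.numNodes]; omega, fun i j hij => ?_⟩
      simp only [IsDescendant, hl, hr] at hij
      rcases hij with ⟨hj, -⟩ | ⟨hj, hi, hij⟩ | ⟨hj, hi, hij⟩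
      · rw [Fin.ext hj]
        exact hk i
      · exact hfl ⟨i, hi⟩ ⟨j, hj⟩ hij
      · simpa only [Nat.sub_add_cancel hi, Nat.sub_add_cancel hj] using
          hfr ⟨i - (k + 1), by omega⟩ ⟨j - (k + 1), by omega⟩ hij

theorem isCartesianTree_neg {G : Type*} [AddGroup G] [LE G] [AddLeftMono G] [AddRightMono G]
    {T : BinaryTree Unit} {f : Fin n → G} :
    IsCartesianTree T (fun i => -f i) ↔ IsCartesianTree T fun i => OrderDual.toDual (f i) := by
  simp only [IsCartesianTree, neg_le_neg_iff, OrderDual.toDual_le_toDual]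

/-- The lowest common ancestor as an operation on `Fin n`, so that it can index the coordinates of
`ℝⁿ`. -/
def lcaFin {T : BinaryTree Unit} (hT : T.numNodes = n) (a b : Fin n) : Fin n :=
  ⟨lca T a b, by
    subst hT
    exact (isDescendant_lca_left a.2 b.2).lt.2⟩

variable {T T' : BinaryTree Unit} {f : Fin n → L}

theorem lcaFin_eq_iff (hT : T.numNodes = n) {a b i : Fin n} :
    lcaFin hT a b = i ↔
      i ∈ Set.uIcc a b ∧ IsDescendant T a i ∧ IsDescendant T b i := by
  rw [Fin.ext_iff, lcaFin, lca_eq_iff (hT ▸ a.2) (hT ▸ b.2)]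
  simp only [Set.mem_uIcc, Fin.le_def]

theorem IsCartesianTree.le_lcaFin [LE L] (h : IsCartesianTree T f) {a b i : Fin n}
    (hi : i ∈ Set.uIcc a b) : f i ≤ f (lcaFin h.1 a b) := by
  obtain ⟨-, ha, hb⟩ := (lcaFin_eq_iff h.1).1 (rfl : lcaFin h.1 a b = _)
  refine h.2 _ _ (ha.of_mem_uIcc hb ?_)
  simpa only [Set.mem_uIcc, Fin.le_def] using hi

theorem IsCartesianTree.eq_of_injective [PartialOrder L] (h : IsCartesianTree T f)
    (h' : IsCartesianTree T' f) (hf : Function.Injective f) : T = T' := by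
  refine eq_of_isDescendant_imp (h.1.trans h'.1.symm) fun i j hij => ?_
  lift i to Fin n using h.1 ▸ hij.lt.1
  lift j to Fin n using h.1 ▸ hij.lt.2
  obtain ⟨hmem, hi, -⟩ := (lcaFin_eq_iff h'.1).1 (rfl : lcaFin h'.1 i j = _)
  have hle : f (lcaFin h'.1 i j) ≤ f j := h.2 _ _ <| hij.of_mem_uIcc (.refl hij.lt.2) <| by
    simpa only [Set.mem_uIcc, Fin.le_def] using hmem
  rwa [hf (hle.antisymm (h'.le_lcaFin Set.right_mem_uIcc))] at hi

end CartesianTree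

section LodayPoint

variable {n : ℕ} {T T' : BinaryTree Unit} {c : Fin n → ℝ}

theorem leafProduct_eq_card (hT : T.numNodes = n) (i : Fin n) :
    leafProduct T i = #{p : Fin n × Fin n | p.1 ≤ p.2 ∧ lcaFin hT p.1 p.2 = i} := by
  obtain ⟨l, r, hsub, hl, hr, hdesc⟩ := exists_subtreeAt_eq_node (i.2.trans_eq hT.symm)
  rw [hT] at hr
  have hbox : ({p : Fin n × Fin n | p.1 ≤ p.2 ∧ lcaFin hT p.1 p.2 = i} : Finset _) =
      Finset.Icc ⟨i - l.numNodes, by omega⟩ i ×ˢ Finset.Icc i ⟨i + r.numNodes, hr⟩ := by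
    ext ⟨a, b⟩
    simp only [Finset.mem_filter, Finset.mem_univ, true_and, lcaFin_eq_iff, hdesc, Set.mem_uIcc,
      Finset.mem_product, Finset.mem_Icc, Fin.le_def]
    omega
  rw [hbox, Finset.card_product, Fin.card_Icc, Fin.card_Icc, leafProduct, hsub, rootLeafProduct,
    BinaryTree.numLeaves_eq_numNodes_succ, BinaryTree.numLeaves_eq_numNodes_succ]
  congr 1 <;> dsimp only <;> omega

/-- Loday's point of the tree `T`, one of the points whose convex hull is `associahedron n`; it is
meaningful when `T` has `n` nodes. -/
def lodayPoint (T : BinaryTree Unit) (n : ℕ) (i : Fin n) : ℝ :=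
  leafProduct T i

theorem lodayPoint_eq_sum_single (hT : T.numNodes = n) :
    lodayPoint T n = ∑ p : Fin n × Fin n with p.1 ≤ p.2, Pi.single (lcaFin hT p.1 p.2) 1 := by
  ext i
  simp only [lodayPoint, leafProduct_eq_card hT, Finset.sum_apply, Pi.single_apply,
    eq_comm (a := i), Finset.sum_boole, Finset.filter_filter]

theorem dotProduct_lodayPoint (hT : T.numNodes = n) (c : Fin n → ℝ) :
    c ⬝ᵥ lodayPoint T n = ∑ p : Fin n × Fin n with p.1 ≤ p.2, c (lcaFin hT p.1 p.2) := by
  simp only [lodayPoint_eq_sum_single hT, dotProduct_sum, dotProduct_single, mul_one]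

theorem sum_lodayPoint (hT : T.numNodes = n) :
    ∑ i, lodayPoint T n i = ((n + 1).choose 2 : ℝ) := by
  have hcard : #{p : Fin n × Fin n | p.1 ≤ p.2} = (n + 1).choose 2 := by
    rw [← Fintype.card_subtype, ← Fintype.card_congr Sym2.sortEquiv, Sym2.card, Fintype.card_fin]
  rw [← one_dotProduct, dotProduct_lodayPoint hT, ← hcard]
  simp

theorem IsCartesianTree.dotProduct_lodayPoint_le (h : IsCartesianTree T c)
    (hT' : T'.numNodes = n) : c ⬝ᵥ lodayPoint T' n ≤ c ⬝ᵥ lodayPoint T n := by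
  rw [dotProduct_lodayPoint hT', dotProduct_lodayPoint h.1]
  exact Finset.sum_le_sum fun p _ => h.le_lcaFin ((lcaFin_eq_iff hT').1 rfl).1

theorem IsCartesianTree.of_dotProduct_lodayPoint_eq (h : IsCartesianTree T c)
    (hT' : T'.numNodes = n) (heq : c ⬝ᵥ lodayPoint T' n = c ⬝ᵥ lodayPoint T n) :
    IsCartesianTree T' c := by
  have hle (p : Fin n × Fin n) : c (lcaFin hT' p.1 p.2) ≤ c (lcaFin h.1 p.1 p.2) :=
    h.le_lcaFin ((lcaFin_eq_iff hT').1 rfl).1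
  rw [dotProduct_lodayPoint hT', dotProduct_lodayPoint h.1,
    Finset.sum_eq_sum_iff_of_le fun p _ => hle p] at heq
  have hle_of_mem {a b i j : Fin n} (hab : a ≤ b) (hi : i ∈ Set.uIcc a b)
      (hj : lcaFin hT' a b = j) : c i ≤ c j := by
    rw [← hj, heq (a, b) (by simpa using hab)]
    exact h.le_lcaFin hi
  refine ⟨hT', fun i j hij => ?_⟩
  have hj := IsDescendant.refl hij.lt.2
  rcases le_total i j with h_le | h_le
  · exact hle_of_mem h_le Set.left_mem_uIcc
      ((lcaFin_eq_iff hT').2 ⟨Set.right_mem_uIcc, hij, hj⟩)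
  · exact hle_of_mem h_le Set.right_mem_uIcc
      ((lcaFin_eq_iff hT').2 ⟨Set.left_mem_uIcc, hj, hij⟩)

theorem lodayPoint_mem_associahedron (hT : T.numNodes = n) :
    lodayPoint T n ∈ associahedron n :=
  subset_convexHull ℝ _ ⟨T, hT, fun _ => rfl⟩

theorem IsCartesianTree.dotProduct_le_of_mem_associahedron (h : IsCartesianTree T c)
    {p : Fin n → ℝ} (hp : p ∈ associahedron n) : c ⬝ᵥ p ≤ c ⬝ᵥ lodayPoint T n := by
  refine convexHull_min ?_ (convex_setOf_dotProduct_le c _) hp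
  rintro v ⟨T', hT', hv⟩
  obtain rfl : v = lodayPoint T' n := funext hv
  exact h.dotProduct_lodayPoint_le hT'

end LodayPoint

section OrderCones

variable {α : Type*}

theorem exists_injective_monotone [PartialOrder α] [Countable α] :
    ∃ c : α → ℝ, Function.Injective c ∧ Monotone c := by
  have : Countable (LinearExtension α) := ‹Countable α›
  obtain ⟨e⟩ := Order.embedding_from_countable_to_dense (LinearExtension α) ℝ
  exact ⟨fun x => e (toLinearExtension x), e.injective,
    fun x y h => e.monotone (toLinearExtension.monotone h)⟩

theorem mem_interior_setOf_forall_le_of_injective [Finite α] {r : α → α → Prop} {c : α → ℝ}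
    (hinj : Function.Injective c) (hc : ∀ x y, r x y → c x ≤ c y) :
    c ∈ interior {d : α → ℝ | ∀ x y, r x y → d x ≤ d y} := by
  rw [mem_interior_iff_mem_nhds]
  simp only [Filter.eventually_all, ← Filter.eventually_iff]
  intro x y hxy
  rcases eq_or_ne x y with rfl | hne
  · exact .of_forall fun d => le_rfl
  · have hlt : c x < c y := (hc x y hxy).lt_of_ne (hinj.ne hne)
    exact ((continuous_apply x).continuousAt.eventually_lt (continuous_apply y).continuousAt
      hlt).mono fun d hd => hd.le

end OrderCones

section Rank

/-- `ρ x` is the rank of `x` for the relation `r`: the largest length of a chain `r x₁ x₀`,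
`r x₂ x₁`, … starting at `x₀ = x`. The characterization gives the two inequalities at once, the
case `ρ x = 0` included. The part function of a bitree is such a rank. -/
def IsRank {α : Type*} (r : α → α → Prop) (ρ : α → ℕ) : Prop :=
  ∀ x k, k < ρ x ↔ ∃ y, r y x ∧ k ≤ ρ y

variable {α : Type*} {r : α → α → Prop} {ρ ρ' : α → ℕ} {x y : α}

theorem exists_isRank [Finite α] (hr : WellFounded r) : ∃ ρ : α → ℕ, IsRank r ρ := by
  classical
  have := Fintype.ofFinite α
  let ρ : α → ℕ := hr.fix fun x ih => Finset.univ.sup fun y => if h : r y x then ih y h + 1 else 0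
  have hρ (x : α) : ρ x = Finset.univ.sup fun y => if r y x then ρ y + 1 else 0 := hr.fix_eq _ x
  refine ⟨ρ, fun x k => ?_⟩
  rw [hρ, Finset.lt_sup_iff]
  refine exists_congr fun y => ?_
  split_ifs with h <;> simp [h]

theorem IsRank.unique (h : IsRank r ρ) (h' : IsRank r ρ') : ρ = ρ' := by
  have hiff (k : ℕ) : ∀ x, k < ρ x ↔ k < ρ' x := by
    induction k with
    | zero => simp [h _ 0, h' _ 0]
    | succ k ih => simp only [h _ (k + 1), h' _ (k + 1), Nat.succ_le_iff, ih, implies_true]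
  exact funext fun x => eq_of_forall_lt_iff fun k => hiff k x

theorem IsRank.lt (h : IsRank r ρ) (hyx : r y x) : ρ y < ρ x :=
  (h x _).2 ⟨y, hyx, le_rfl⟩

theorem IsRank.le_of_imp (h : IsRank r ρ) (hxy : ∀ z, r z x → r z y) : ρ x ≤ ρ y :=
  le_of_forall_lt fun k hk => (h y k).2 (((h x k).1 hk).imp fun z hz => hz.imp_left (hxy z))

theorem IsRank.exists_of_eq_succ (h : IsRank r ρ) {k : ℕ} (hx : ρ x = k + 1) :
    ∃ y, r y x ∧ ρ y = k := by
  obtain ⟨y, hyx, hky⟩ := (h x k).1 (by omega)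
  have := h.lt hyx
  exact ⟨y, hyx, by omega⟩

theorem IsRank.exists_eq (h : IsRank r ρ) (x : α) : ∀ k < ρ x, ∃ y, ρ y = k := by
  induction hn : ρ x generalizing x with
  | zero => simp
  | succ n ih =>
    obtain ⟨y, -, hy⟩ := h.exists_of_eq_succ hn
    intro k hk
    rcases (Nat.lt_succ_iff.1 hk).lt_or_eq with hk | rfl
    · exact ih y hy k hk
    · exact ⟨y, hy⟩

end Rank

namespace BinaryBitree

variable {m n : ℕ} (B : BinaryBitree m n)

theorem rel_refl (x : Fin m ⊕ Fin n) : B.Rel x x := by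
  rcases x with i | j
  · exact Or.inr (Or.inl ⟨i, i, rfl, rfl, .refl (i.2.trans_eq B.numNodes_U.symm)⟩)
  · exact Or.inr (Or.inr ⟨j, j, rfl, rfl, .refl (j.2.trans_eq B.numNodes_D.symm)⟩)

variable {B} {x y z : Fin m ⊕ Fin n}

theorem Rel.part_le (h : B.Rel x y) : B.μ.part x ≤ B.μ.part y := by
  rcases h with h | ⟨i, j, rfl, rfl, h⟩ | ⟨i, j, rfl, rfl, h⟩
  · exact h.le
  · exact B.up _ _ h
  · exact B.down _ _ h

theorem Rel.trans (hxy : B.Rel x y) (hyz : B.Rel y z) : B.Rel x z := by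
  have hxy' := hxy.part_le
  have hyz' := hyz.part_le
  simp only [Rel] at *
  grind [IsDescendant.trans]

theorem Rel.antisymm (hxy : B.Rel x y) (hyx : B.Rel y x) : x = y := by
  have hxy' := hxy.part_le
  have hyx' := hyx.part_le
  simp only [Rel] at *
  grind [IsDescendant.antisymm]

variable (B)

/-- The order `≼` of a bitree. It is not an instance, as `Fin m ⊕ Fin n` already carries the
disjoint sum of the orders of its summands. -/
abbrev partialOrder : PartialOrder (Fin m ⊕ Fin n) where
  le := B.Rel
  lt x y := B.Rel x y ∧ ¬ B.Rel y x
  lt_iff_le_not_ge _ _ := Iff.rfl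
  le_refl := B.rel_refl
  le_trans _ _ _ := Rel.trans
  le_antisymm _ _ := Rel.antisymm

theorem exists_injective_mem_cone : ∃ c ∈ B.cone, Function.Injective c := by
  obtain ⟨c, hinj, hc⟩ := @exists_injective_monotone _ B.partialOrder _
  exact ⟨c, fun x y hxy => hc hxy, hinj⟩

theorem exists_between (hxy : x.isLeft = y.isLeft) (h : B.μ.part x < B.μ.part y) :
    ∃ z, z.isLeft ≠ x.isLeft ∧ B.μ.part x < B.μ.part z ∧ B.μ.part z < B.μ.part y := by
  have hne : B.μ.part x + 1 ≠ B.μ.part y := fun he => B.alternating x y he.symm hxy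
  obtain ⟨z, hz⟩ := B.μ.exists_part_eq y (B.μ.part x + 1) (by omega)
  exact ⟨z, (B.alternating x z hz).symm, by omega, by omega⟩

theorem forall_rel_le_iff {L : Type*} [Preorder L] (f : Fin m ⊕ Fin n → L) :
    (∀ x y, B.Rel x y → f x ≤ f y) ↔
      IsCartesianTree B.U (fun i => OrderDual.toDual (f (Sum.inl i))) ∧
      IsCartesianTree B.D (fun j => f (Sum.inr j)) ∧
      ∀ x y, x.isLeft ≠ y.isLeft → B.μ.part x < B.μ.part y → f x ≤ f y := by
  constructor
  · intro h
    exact ⟨⟨B.numNodes_U, fun i j hij => h _ _ (Or.inr (Or.inl ⟨j, i, rfl, rfl, hij⟩))⟩,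
      ⟨B.numNodes_D, fun i j hij => h _ _ (Or.inr (Or.inr ⟨i, j, rfl, rfl, hij⟩))⟩,
      fun x y _ hxy => h _ _ (Or.inl hxy)⟩
  · rintro ⟨hU, hD, hf⟩ x y (h | ⟨i, j, rfl, rfl, h⟩ | ⟨i, j, rfl, rfl, h⟩)
    · by_cases hxy : x.isLeft = y.isLeft
      · obtain ⟨z, hz, hxz, hzy⟩ := B.exists_between hxy h
        exact (hf x z hz.symm hxz).trans (hf z y (hxy ▸ hz) hzy)
      · exact hf x y hxy h
    · exact hU.2 _ _ h
    · exact hD.2 _ _ h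

theorem isRank_part :
    IsRank (fun y x => y.isLeft ≠ x.isLeft ∧ B.μ.part y < B.μ.part x) B.μ.part := by
  intro x k
  constructor
  · intro hk
    obtain ⟨y, hy⟩ := B.μ.exists_part_eq x (B.μ.part x - 1) (by omega)
    exact ⟨y, ⟨B.alternating y x (by omega), by omega⟩, by omega⟩
  · rintro ⟨y, ⟨-, hyx⟩, hk⟩
    exact hk.trans_lt hyx

variable {B} {B' : BinaryBitree m n} {L : Type*}

theorem part_lt_iff_of_forall_rel_le [PartialOrder L] {f : Fin m ⊕ Fin n → L}
    (hf : Function.Injective f) (h : ∀ x y, B.Rel x y → f x ≤ f y) (hxy : x.isLeft ≠ y.isLeft) :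
    B.μ.part x < B.μ.part y ↔ f x < f y := by
  have hlt {x y} (hlt : B.μ.part x < B.μ.part y) : f x < f y :=
    (h x y (Or.inl hlt)).lt_of_ne (hf.ne fun he => hlt.ne (congrArg _ he))
  refine ⟨hlt, fun hfxy => lt_of_not_ge fun hle => ?_⟩
  exact hfxy.not_gt (hlt (hle.lt_of_ne fun he => hxy (B.pure y x he).symm))

theorem eq_of_forall_rel_le [PartialOrder L] {f : Fin m ⊕ Fin n → L} (hf : Function.Injective f)
    (h : ∀ x y, B.Rel x y → f x ≤ f y) (h' : ∀ x y, B'.Rel x y → f x ≤ f y) : B = B' := by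
  obtain ⟨hU, hD, -⟩ := (B.forall_rel_le_iff f).1 h
  obtain ⟨hU', hD', -⟩ := (B'.forall_rel_le_iff f).1 h'
  refine BinaryBitree.ext (hU.eq_of_injective hU' ?_) (hD.eq_of_injective hD' ?_)
    (OrderedPartition.ext (B.isRank_part.unique ?_))
  · exact OrderDual.toDual.injective.comp (hf.comp Sum.inl_injective)
  · exact hf.comp Sum.inr_injective
  · have hrel (y x) : (y.isLeft ≠ x.isLeft ∧ B.μ.part y < B.μ.part x) =
        (y.isLeft ≠ x.isLeft ∧ B'.μ.part y < B'.μ.part x) := by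
      refine propext (and_congr_right fun hyx => ?_)
      rw [part_lt_iff_of_forall_rel_le hf h hyx, part_lt_iff_of_forall_rel_le hf h' hyx]
    simpa only [hrel] using B'.isRank_part

theorem exists_forall_rel_le [LinearOrder L] (f : Fin m ⊕ Fin n → L)
    (hf : ∀ x y, x.isLeft ≠ y.isLeft → f x ≠ f y) :
    ∃ B : BinaryBitree m n, ∀ x y, B.Rel x y → f x ≤ f y := by
  let r (y x : Fin m ⊕ Fin n) : Prop := y.isLeft ≠ x.isLeft ∧ f y < f x
  have hr : WellFounded r :=
    Subrelation.wf And.right (Finite.wellFounded_of_trans_of_irrefl (InvImage (· < ·) f))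
  obtain ⟨ρ, hρ⟩ := exists_isRank hr
  obtain ⟨U, hU⟩ := exists_isCartesianTree fun i : Fin m => OrderDual.toDual (f (Sum.inl i))
  obtain ⟨D, hD⟩ := exists_isCartesianTree fun j : Fin n => f (Sum.inr j)
  have hmono {x y} (hxy : x.isLeft = y.isLeft) (hle : f x ≤ f y) : ρ x ≤ ρ y :=
    hρ.le_of_imp fun z hz => ⟨hxy ▸ hz.1, hz.2.trans_le hle⟩
  have hpure (x y) (h : ρ x = ρ y) : x.isLeft = y.isLeft := by
    by_contra hne
    rcases lt_or_gt_of_ne (hf x y hne) with hlt | hlt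
    · exact (hρ.lt ⟨hne, hlt⟩).ne h
    · exact (hρ.lt ⟨Ne.symm hne, hlt⟩).ne' h
  have halt (x y) (h : ρ y = ρ x + 1) : x.isLeft ≠ y.isLeft := by
    obtain ⟨z, hzy, hz⟩ := hρ.exists_of_eq_succ h
    exact hpure z x hz ▸ hzy.1
  let B : BinaryBitree m n :=
    ⟨U, D, ⟨ρ, hρ.exists_eq⟩, hU.1, hD.1, fun i j hij => hmono rfl (hU.2 i j hij),
      fun i j hij => hmono rfl (hD.2 i j hij), hpure, halt⟩
  refine ⟨B, (B.forall_rel_le_iff f).2 ⟨hU, hD, fun x y hxy hlt => ?_⟩⟩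
  exact le_of_not_gt fun hfyx => hlt.not_gt (hρ.lt ⟨Ne.symm hxy, hfyx⟩)

theorem exists_mem_cone (c : Fin m ⊕ Fin n → ℝ) : ∃ B : BinaryBitree m n, c ∈ B.cone := by
  -- Parts are pure, so ties of `c` between the two trees have to be broken.
  obtain ⟨B, hB⟩ := exists_forall_rel_le (fun x => toLex (c x, x.isLeft))
    fun x y hxy h => hxy (Prod.ext_iff.1 (toLex.injective h)).2
  exact ⟨B, fun x y hxy => Prod.Lex.monotone_fst _ _ (hB x y hxy)⟩

theorem cone_injective : Function.Injective (cone : BinaryBitree m n → _) := by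
  intro B B' h
  obtain ⟨c, hc, hinj⟩ := B.exists_injective_mem_cone
  exact eq_of_forall_rel_le hinj hc (h ▸ hc : c ∈ B'.cone)

/-- The one of the node of `U` labelled `i` and the node of `D` labelled `j` whose part comes later
(no part contains both). It selects the end of the segment `[eᵢ, eₘ₊ⱼ]` that contributes to the
vertex of `B`. -/
def laterNode (B : BinaryBitree m n) (i : Fin m) (j : Fin n) : Fin m ⊕ Fin n :=
  if B.μ.part (Sum.inl i) < B.μ.part (Sum.inr j) then Sum.inr j else Sum.inl i

/-- The vertex of the biassociahedron corresponding to `B`, given by its coordinates. -/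
noncomputable def vertex (B : BinaryBitree m n) : Fin m ⊕ Fin n → ℝ :=
  Sum.elim (fun i => (m + 1 : ℝ) - leafProduct B.U i + B.numBelowU i)
    (fun j => (leafProduct B.D j : ℝ) + B.numBelowD j)

section LaterNode

variable (B) {i k : Fin m} {j l : Fin n}

theorem part_inl_ne_part_inr (i : Fin m) (j : Fin n) :
    B.μ.part (Sum.inl i) ≠ B.μ.part (Sum.inr j) :=
  fun h => Bool.noConfusion (B.pure _ _ h)

theorem laterNode_eq_inl_iff :
    B.laterNode i j = Sum.inl k ↔ i = k ∧ B.μ.part (Sum.inr j) < B.μ.part (Sum.inl i) := by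
  have := B.part_inl_ne_part_inr i j
  grind [laterNode]

theorem laterNode_eq_inr_iff :
    B.laterNode i j = Sum.inr l ↔ j = l ∧ B.μ.part (Sum.inl i) < B.μ.part (Sum.inr j) := by
  grind [laterNode]

theorem laterNode_eq_or (i : Fin m) (j : Fin n) :
    B.laterNode i j = Sum.inl i ∨ B.laterNode i j = Sum.inr j :=
  (ite_eq_or_eq _ _ _).symm

theorem mem_cone_iff {c : Fin m ⊕ Fin n → ℝ} :
    c ∈ B.cone ↔ IsCartesianTree B.U (fun i => -c (Sum.inl i)) ∧
      IsCartesianTree B.D (fun j => c (Sum.inr j)) ∧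
      ∀ i j, c (Sum.inl i) ≤ c (B.laterNode i j) ∧ c (Sum.inr j) ≤ c (B.laterNode i j) := by
  rw [isCartesianTree_neg]
  refine (B.forall_rel_le_iff c).trans (and_congr_right fun _ => and_congr_right fun _ => ?_)
  constructor
  · intro h i j
    have := B.part_inl_ne_part_inr i j
    have := h (Sum.inl i) (Sum.inr j) (by simp)
    have := h (Sum.inr j) (Sum.inl i) (by simp)
    grind [laterNode]
  · rintro h (i | i) (j | j) hne hlt
    · simp at hne
    · rw [← B.laterNode_eq_inr_iff.2 ⟨rfl, hlt⟩]
      exact (h i j).1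
    · rw [← B.laterNode_eq_inl_iff.2 ⟨rfl, hlt⟩]
      exact (h j i).2
    · simp at hne

end LaterNode

section Vertex

theorem vertex_eq (B : BinaryBitree m n) :
    B.vertex = Sum.elim (fun i => (m + 1 : ℝ) - lodayPoint B.U m i) (lodayPoint B.D n) +
      ∑ i, ∑ j, Pi.single (B.laterNode i j) 1 := by
  ext (k | k)
  · simp [vertex, numBelowU, lodayPoint, Finset.sum_apply, Pi.single_apply,
      eq_comm (a := Sum.inl k), laterNode_eq_inl_iff, ite_and, Finset.sum_ite_irrel]
  · simp [vertex, numBelowD, lodayPoint, Finset.sum_apply, Pi.single_apply,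
      eq_comm (a := Sum.inr k), laterNode_eq_inr_iff, ite_and]

theorem dotProduct_vertex (B : BinaryBitree m n) (c : Fin m ⊕ Fin n → ℝ) :
    c ⬝ᵥ B.vertex = (m + 1) * ∑ i, c (Sum.inl i) +
      (fun i => -c (Sum.inl i)) ⬝ᵥ lodayPoint B.U m + (fun j => c (Sum.inr j)) ⬝ᵥ lodayPoint B.D n +
      ∑ i, ∑ j, c (B.laterNode i j) := by
  simp only [vertex_eq, dotProduct_add, dotProduct_sumElim_sub, dotProduct_sum, dotProduct_single,
    mul_one]

theorem sum_vertex (B : BinaryBitree m n) :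
    ∑ x, B.vertex x = ((m + 1).choose 2 : ℝ) + ((n + 1).choose 2 : ℝ) + (m : ℝ) * (n : ℝ) := by
  have hU : (fun _ : Fin m => (-1 : ℝ)) ⬝ᵥ lodayPoint B.U m = -((m + 1).choose 2 : ℝ) := by
    simp [dotProduct, sum_lodayPoint B.numNodes_U]
  have hD : (fun _ : Fin n => (1 : ℝ)) ⬝ᵥ lodayPoint B.D n = ((n + 1).choose 2 : ℝ) := by
    simp [dotProduct, sum_lodayPoint B.numNodes_D]
  have hchoose : ((m + 1).choose 2 : ℝ) = (m + 1) * m / 2 := by simp [Nat.cast_choose_two]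
  have hsum := B.dotProduct_vertex 1
  simp only [one_dotProduct, Pi.one_apply, hU, hD, Finset.sum_const, Finset.card_univ,
    Fintype.card_fin, nsmul_eq_mul, mul_one] at hsum
  rw [hsum, hchoose]
  ring

theorem vertex_mem (B : BinaryBitree m n) : B.vertex ∈ biassociahedron m n := by
  rw [vertex_eq]
  refine Set.add_mem_add ⟨⟨_, lodayPoint_mem_associahedron B.numNodes_U, fun i => rfl⟩,
    lodayPoint_mem_associahedron B.numNodes_D⟩ ?_
  refine Set.finsetSum_mem_finsetSum _ _ _ fun i _ => ?_
  refine Set.finsetSum_mem_finsetSum _ _ _ fun j _ => ?_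
  rcases B.laterNode_eq_or i j with h | h <;> rw [h]
  · exact left_mem_segment ℝ _ _
  · exact right_mem_segment ℝ _ _

variable {c p : Fin m ⊕ Fin n → ℝ}

theorem dotProduct_le_of_mem_bipartiteZonotope (hc : c ∈ B.cone) (hp : p ∈ bipartiteZonotope m n) :
    c ⬝ᵥ p ≤ ∑ i, ∑ j, c (B.laterNode i j) := by
  refine dotProduct_le_sum_of_mem_sum (fun i q hq => ?_) hp
  refine dotProduct_le_sum_of_mem_sum (fun j q hq => ?_) hq
  obtain ⟨hi, hj⟩ := (B.mem_cone_iff.1 hc).2.2 i j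
  exact (convex_setOf_dotProduct_le c _).segment_subset (by simpa using hi) (by simpa using hj) hq

theorem dotProduct_le_vertex (hc : c ∈ B.cone) (hp : p ∈ biassociahedron m n) :
    c ⬝ᵥ p ≤ c ⬝ᵥ B.vertex := by
  obtain ⟨q, ⟨⟨y, hy, hqy⟩, hz⟩, r, hr, rfl⟩ := hp
  have hq : q = Sum.elim (fun i => (m + 1 : ℝ) - y i) (fun j => q (Sum.inr j)) := by
    ext (i | j)
    · exact hqy i
    · rfl
  obtain ⟨hU, hD, -⟩ := B.mem_cone_iff.1 hc
  rw [dotProduct_add, dotProduct_vertex, hq, dotProduct_sumElim_sub]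
  gcongr
  · exact hU.dotProduct_le_of_mem_associahedron hy
  · exact hD.dotProduct_le_of_mem_associahedron hz
  · exact dotProduct_le_of_mem_bipartiteZonotope hc hr

theorem mem_cone_of_dotProduct_vertex_eq (hc : c ∈ B.cone)
    (heq : c ⬝ᵥ B'.vertex = c ⬝ᵥ B.vertex) : c ∈ B'.cone := by
  obtain ⟨hU, hD, hlater⟩ := B.mem_cone_iff.1 hc
  have hU_le := hU.dotProduct_lodayPoint_le B'.numNodes_U
  have hD_le := hD.dotProduct_lodayPoint_le B'.numNodes_D
  have hlater_le (i j) : c (B'.laterNode i j) ≤ c (B.laterNode i j) := by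
    rcases B'.laterNode_eq_or i j with h | h <;> rw [h]
    exacts [(hlater i j).1, (hlater i j).2]
  have hsum_le (i) : ∑ j, c (B'.laterNode i j) ≤ ∑ j, c (B.laterNode i j) :=
    Finset.sum_le_sum fun j _ => hlater_le i j
  have hsum_sum_le := Finset.sum_le_sum fun i (_ : i ∈ Finset.univ) => hsum_le i
  rw [dotProduct_vertex, dotProduct_vertex] at heq
  have hsum_sum_eq : ∑ i, ∑ j, c (B'.laterNode i j) = ∑ i, ∑ j, c (B.laterNode i j) := by linarith
  have hlater_eq (i j) : c (B'.laterNode i j) = c (B.laterNode i j) :=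
    (Finset.sum_eq_sum_iff_of_le fun j _ => hlater_le i j).1
      ((Finset.sum_eq_sum_iff_of_le fun i _ => hsum_le i).1 hsum_sum_eq i (Finset.mem_univ i))
      j (Finset.mem_univ j)
  refine B'.mem_cone_iff.2 ⟨hU.of_dotProduct_lodayPoint_eq B'.numNodes_U (by linarith),
    hD.of_dotProduct_lodayPoint_eq B'.numNodes_D (by linarith), fun i j => ?_⟩
  rw [hlater_eq]
  exact hlater i j

theorem normalCone_vertex (B : BinaryBitree m n) :
    normalCone (biassociahedron m n) {B.vertex} = B.cone := by
  refine Set.Subset.antisymm (fun c hc => ?_) ?_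
  · obtain ⟨B', hB'⟩ := exists_mem_cone c
    exact mem_cone_of_dotProduct_vertex_eq hB'
      ((dotProduct_le_vertex hB' B.vertex_mem).antisymm (hc _ rfl _ B'.vertex_mem))
  · rintro c hc _ rfl p hp
    exact dotProduct_le_vertex hc hp

theorem nonempty_interior_cone (B : BinaryBitree m n) : (interior B.cone).Nonempty := by
  obtain ⟨c, hc, hinj⟩ := B.exists_injective_mem_cone
  exact ⟨c, mem_interior_setOf_forall_le_of_injective hinj hc⟩

theorem isVertexOf_vertex (B : BinaryBitree m n) : B.IsVertexOf B.vertex := by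
  obtain ⟨c, hc⟩ := B.nonempty_interior_cone
  rw [← B.normalCone_vertex] at hc
  exact ⟨isVertex_of_mem_interior_normalCone B.vertex_mem hc, B.normalCone_vertex⟩

theorem IsVertexOf.eq_vertex {v : Fin m ⊕ Fin n → ℝ} (h : B.IsVertexOf v) : v = B.vertex :=
  eq_of_normalCone_eq h.1.mem B.vertex_mem (h.2.trans B.normalCone_vertex.symm)
    (B.normalCone_vertex ▸ B.nonempty_interior_cone)

theorem exists_isVertexOf {v : Fin m ⊕ Fin n → ℝ} (hv : IsVertex (biassociahedron m n) v) :
    ∃ B : BinaryBitree m n, B.IsVertexOf v := by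
  obtain ⟨c, hc⟩ := hv.exists_unique_maximizer
  obtain ⟨B, hB⟩ := exists_mem_cone c
  exact ⟨B, hc _ B.vertex_mem (fun q hq => dotProduct_le_vertex hB hq) ▸ B.isVertexOf_vertex⟩

end Vertex

end BinaryBitree

end Biassociahedra

theorem mainTheorem9 (m n : ℕ) :
    (∀ B : Biassociahedra.BinaryBitree m n, ∃! v : Fin m ⊕ Fin n → ℝ, B.IsVertexOf v) ∧
    (∀ v : Fin m ⊕ Fin n → ℝ,
      Biassociahedra.IsVertex (Biassociahedra.biassociahedron m n) v →
        ∃! B : Biassociahedra.BinaryBitree m n, B.IsVertexOf v) ∧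
    (∀ (B : Biassociahedra.BinaryBitree m n) (v : Fin m ⊕ Fin n → ℝ), B.IsVertexOf v →
      (∀ i : Fin m, v (Sum.inl i) =
        (m + 1 : ℝ) - (Biassociahedra.leafProduct B.U i : ℝ) + (B.numBelowU i : ℝ)) ∧
      (∀ j : Fin n, v (Sum.inr j) =
        (Biassociahedra.leafProduct B.D j : ℝ) + (B.numBelowD j : ℝ)) ∧
      ∑ x, v x = ((m + 1).choose 2 : ℝ) + ((n + 1).choose 2 : ℝ) + (m : ℝ) * (n : ℝ)) := by
  refine ⟨fun B => ⟨B.vertex, B.isVertexOf_vertex, fun v hv => hv.eq_vertex⟩, fun v hv => ?_,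
    fun B v hv => ?_⟩
  · obtain ⟨B, hB⟩ := Biassociahedra.BinaryBitree.exists_isVertexOf hv
    exact ⟨B, hB, fun B' hB' => Biassociahedra.BinaryBitree.cone_injective (hB'.2.symm.trans hB.2)⟩
  · obtain rfl := hv.eq_vertex
    exact ⟨fun i => rfl, fun j => rfl, B.sum_vertex⟩
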